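/- For a set $X$ let $LX$ be the set of finite lists of elements of $X$ (including the empty list). An *$(L,\mathbf 2)$-category* (ordered multicategory) is a set $X$ with a relation $a\subseteq LX\times X$ such that $((x),x)\in a$ for all $x\in X$, and such that $(\underline z_i,x_i)\in a$ for $i=1,\dots,n$ and $((x_1,\dots,x_n),y)\in a$ imply $((\underline z_1;\dots;\underline z_n),y)\in a$, where $;$ is concatenation and $n\ge 0$. An *$(L,\mathbf 2)$-functor* $f:(X,a)\to(Y,b)$ is a map with $(\underline x,y)\in a\Rightarrow (Lf(\underline x),f(y))\in b$, where $Lf$ applies $f$ to every entry of a list; for such functors write $f\simeq g$ if $((f(x)),g(x))\in b$ and $((g(x)),f(x))\in b$ for all $x\in X$. $(X,a)$ is *separated* if $f\simeq g$ implies $f=g$ for all functors $f,g$ into $X$. For relations $r\subseteq LX\times Y$ and $s\subseteq LY\times Z$ let $s\bullet r\subseteq LX\times Z$ consist of all $((\underline x_1;\dots;\underline x_n),z)$ such that there are $y_1,\dots,y_n\in Y$ with $(\underline x_i,y_i)\in r$ for all $i$ and $((y_1,\dots,y_n),z)\in s$. A *distributor* from $(A,a)$ to $(B,b)$ is a relation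 $\varphi\subseteq LA\times B$ with $\varphi\bullet a\subseteq\varphi$ and $b\bullet\varphi\subseteq\varphi$. For a functor $f:(A,a)\to (X,c)$ put $f_\circledast=\{(\underline a,x) : (Lf(\underline a),x)\in c\}\subseteq LA\times X$. A functor $g:B\to X$ is a *$\varphi$-weighted colimit* of a functor $h:A\to X$ if $g_\circledast$ is the largest relation $\psi\subseteq LB\times X$ with $\psi\bullet\varphi\subseteq h_\circledast$. $X$ is *cocomplete* if for all $(L,\mathbf 2)$-categories $A$ and $B$, every functor $h:A\to X$ has a $\varphi$-weighted colimit for every distributor $\varphi$ from $A$ to $B$. A functor $f:X\to Y$ is *cocontinuous* if, whenever $g$ is a $\varphi$-weighted colimit of $h$ in $X$, $f\cdot g$ is a $\varphi$-weighted colimit of $f\cdot h$ in $Y$. Let $\mathtt{Inj}(\mathbf 2)$ be the category of cocomplete separated $(L,\mathbf 2)$-categories and cocontinuous $(L,\mathbf 2)$-functors. Let $\mathtt{Quant}$ be the category whose objects are the (unital, not necessarily commutative) quantales, i.e. complete lattices with a monoid structure whose multiplication preserves arbitrary suprema in each variable (the one-element quantale is included), and whose morphisms are the maps preserving arbitrary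 suprema, the multiplication and the unit. Then there is an equivalence of categories $\mathtt{Inj}(\mathbf 2)\simeq\mathtt{Quant}$. -/

import Mathlib

open CategoryTheory

universe u

/-- An `(L, 𝟐)`-relation from `X` to `Y`: a relation between finite lists in `X` and elements of
`Y`, for the list monad `L`. These are ordered pointwise (by implication). -/
abbrev LRel (X Y : Type u) : Type u := List X → Y → Prop

namespace LRel

/-- The identity `(L, 𝟐)`-relation: the converse of the unit `x ↦ (x)` of the list monad. -/
def one (X : Type u) : LRel X X := fun xs x => xs = [x]

/-- Kleisli composition `s • r = s ∘ L r ∘ m°` of `r` followed by `s`, where `m` is concatenation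
and the extension `L r` relates lists of equal length whose entries are pairwise related. -/
def comp {X Y Z : Type u} (s : LRel Y Z) (r : LRel X Y) : LRel X Z :=
  fun xs z => ∃ (xss : List (List X)) (ys : List Y),
    xss.flatten = xs ∧ List.Forall₂ r xss ys ∧ s ys z

/-- The extension of `χ` along `φ`: the greatest `ψ` with `ψ • φ ≤ χ`, see `comp_le_iff`. -/
def ext {A B X : Type u} (φ : LRel A B) (χ : LRel A X) : LRel B X :=
  fun bs x => ∀ ass : List (List A), List.Forall₂ φ ass bs → χ ass.flatten x

theorem comp_le_iff {A B X : Type u} (φ : LRel A B) (χ : LRel A X) (ψ : LRel B X) :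
    comp ψ φ ≤ χ ↔ ψ ≤ ext φ χ :=
  ⟨fun h bs _ hb ass ha => h _ _ ⟨ass, bs, rfl, ha, hb⟩,
    fun h _ _ ⟨ass, bs, e, ha, hb⟩ => e ▸ h bs _ hb ass ha⟩

end LRel

/-- An `(L, 𝟐)`-category, or ordered multicategory. -/
structure LTwoCat : Type (u + 1) where
  carrier : Type u
  rel : LRel carrier carrier
  one_le : LRel.one carrier ≤ rel
  comp_le : LRel.comp rel rel ≤ rel

namespace LTwoCat

instance : CoeSort LTwoCat.{u} (Type u) := ⟨LTwoCat.carrier⟩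

/-- An `(L, 𝟐)`-functor. -/
@[ext]
structure Functor (X Y : LTwoCat.{u}) : Type u where
  toFun : X → Y
  map_rel : ∀ (xs : List X) (x : X), X.rel xs x → Y.rel (xs.map toFun) (toFun x)

namespace Functor

/-- The identity functor. -/
def id (X : LTwoCat.{u}) : Functor X X where
  toFun := fun x => x
  map_rel := fun xs x h => by simpa using h

/-- The composite `g ∘ f`. -/
def comp {X Y Z : LTwoCat.{u}} (g : Functor Y Z) (f : Functor X Y) : Functor X Z where
  toFun := fun x => g.toFun (f.toFun x)
  map_rel := fun xs x h => by
    simpa [List.map_map, Function.comp_def] using g.map_rel _ _ (f.map_rel _ _ h)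

/-- The order on functors: `f ≤ g` when `f x ≤ g x` for all `x`, in the order of the target. -/
def Le {X Y : LTwoCat.{u}} (f g : Functor X Y) : Prop :=
  ∀ x : X, Y.rel [f.toFun x] (g.toFun x)

/-- The equivalence `f ≃ g` of functors. -/
def Equivalent {X Y : LTwoCat.{u}} (f g : Functor X Y) : Prop := Le f g ∧ Le g f

/-- The `(L, 𝟐)`-relation `f_⊛` represented by a functor `f`, related by `f_⊛ (xs, y)` iff
`(f x₁, …, f xₙ)` is related to `y`. -/
def lowerStar {X Y : LTwoCat.{u}} (f : Functor X Y) : LRel X Y :=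
  fun xs y => Y.rel (xs.map f.toFun) y

end Functor

/-- `X` is separated: equivalent functors into `X` are equal. -/
def IsSeparated (X : LTwoCat.{u}) : Prop :=
  ∀ (Y : LTwoCat.{u}) (f g : Functor Y X), Functor.Equivalent f g → f = g

/-- An `(L, 𝟐)`-distributor. -/
structure Distributor (A B : LTwoCat.{u}) : Type u where
  rel : LRel A B
  comp_le : LRel.comp rel A.rel ≤ rel
  le_comp : LRel.comp B.rel rel ≤ rel

/-- `g : B → X` is a colimit of the diagram `h : A → X` weighted by the distributor `φ` from `A`
to `B`: the relation `g_⊛` is the extension of `h_⊛` along `φ`. -/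
def IsColimit {A B X : LTwoCat.{u}} (φ : Distributor A B) (h : Functor A X) (g : Functor B X) :
    Prop :=
  g.lowerStar = LRel.ext φ.rel h.lowerStar

/-- `X` is cocomplete: every weighted diagram in `X` has a colimit. -/
def IsCocomplete (X : LTwoCat.{u}) : Prop :=
  ∀ (A B : LTwoCat.{u}) (φ : Distributor A B) (h : Functor A X),
    ∃ g : Functor B X, IsColimit φ h g

/-- `f` is cocontinuous: it preserves all weighted colimits. -/
def Functor.IsCocontinuous {X Y : LTwoCat.{u}} (f : Functor X Y) : Prop :=
  ∀ (A B : LTwoCat.{u}) (φ : Distributor A B) (h : Functor A X) (g : Functor B X),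
    IsColimit φ h g → IsColimit φ (f.comp h) (f.comp g)

end LTwoCat

/-- The objects of `Inj(𝟐)`: cocomplete separated `(L, 𝟐)`-categories. -/
structure InjTwo : Type (u + 1) where
  toLTwoCat : LTwoCat.{u}
  isSeparated : toLTwoCat.IsSeparated
  isCocomplete : toLTwoCat.IsCocomplete

namespace InjTwo

/-- The morphisms of `Inj(𝟐)`: cocontinuous functors. -/
@[ext]
structure Hom (X Y : InjTwo.{u}) : Type u where
  toFunctor : LTwoCat.Functor X.toLTwoCat Y.toLTwoCat
  isCocontinuous : toFunctor.IsCocontinuous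

instance : Category.{u} InjTwo.{u} where
  Hom X Y := Hom X Y
  id X := ⟨LTwoCat.Functor.id X.toLTwoCat, fun _ _ _ _ _ hc => hc⟩
  comp f g := ⟨g.toFunctor.comp f.toFunctor,
    fun A B φ h k hc => g.isCocontinuous A B φ _ _ (f.isCocontinuous A B φ h k hc)⟩

end InjTwo

/-- The objects of `Quant`: (unital) quantales. The one-element quantale is included. -/
structure Quant : Type (u + 1) where
  carrier : Type u
  [completeLattice : CompleteLattice carrier]
  [monoid : Monoid carrier]
  [isQuantale : IsQuantale carrier]

namespace Quant

instance : CoeSort Quant.{u} (Type u) := ⟨Quant.carrier⟩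

attribute [instance] Quant.completeLattice Quant.monoid Quant.isQuantale

/-- Morphisms of quantales: maps preserving arbitrary suprema, products and the unit. -/
@[ext]
structure Hom (P Q : Quant.{u}) : Type u extends sSupHom P Q, P →* Q

instance : Category.{u} Quant.{u} where
  Hom P Q := Hom P Q
  id P := { sSupHom.id P, MonoidHom.id P with }
  comp f g := { g.tosSupHom.comp f.tosSupHom, g.toMonoidHom.comp f.toMonoidHom with }

end Quant

/-! A quantale is an ordered multicategory through `x₁ ⋯ xₙ ≤ y`. Since multiplication distributes
over suprema, its weighted colimits are pointwise suprema of products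
(`prod_map_weightedSup_le_iff`). So it is cocomplete, and the cocontinuous functors are exactly the
maps preserving suprema and finite products. Conversely, in a cocomplete separated `X` the
membership weight gives each set `S` of lists an element `sup S` whose universal property holds
inside any surrounding list (`rel_append_sup_append_iff`). Then `sup {[x, y]}` is the product, `sup
{[]}` the unit, and sets of one-entry lists give joins. Associativity and distributivity follow by
working in context, and `prod_le_iff` recovers the original relation of `X`. -/

/-! ### Weighted suprema in a quantale. -/

section Quantale

variable {A B Q : Type u} [CompleteLattice Q] [Monoid Q] [IsQuantale Q]

/-- The pointwise formula for weighted colimits in a quantale. -/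
def weightedSup (φ : LRel A B) (h : A → Q) (b : B) : Q :=
  ⨆ as : {as // φ as b}, (as.1.map h).prod

theorem mul_weightedSup_le_iff (φ : LRel A B) (h : A → Q) (b : B) (c d x : Q) :
    c * weightedSup φ h b * d ≤ x ↔ ∀ as, φ as b → c * (as.map h).prod * d ≤ x := by
  simp only [weightedSup, Quantale.mul_iSup_distrib, Quantale.iSup_mul_distrib, iSup_le_iff,
    Subtype.forall]

omit [IsQuantale Q] in
theorem weightedSup_le_iff (φ : LRel A B) (h : A → Q) (b : B) (x : Q) :
    weightedSup φ h b ≤ x ↔ ∀ as, φ as b → (as.map h).prod ≤ x := by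
  simp only [weightedSup, iSup_le_iff, Subtype.forall]

/-- The left factor `c` makes the induction go through: it absorbs the product of the block already
chosen for the head. -/
theorem mul_prod_map_weightedSup_le_iff (φ : LRel A B) (h : A → Q) (bs : List B) (c x : Q) :
    c * (bs.map (weightedSup φ h)).prod ≤ x ↔
      ∀ ass : List (List A), List.Forall₂ φ ass bs → c * (ass.flatten.map h).prod ≤ x := by
  induction bs generalizing c with
  | nil => simp
  | cons b bs ih =>
    rw [List.map_cons, List.prod_cons, ← mul_assoc, mul_weightedSup_le_iff]
    constructor
    · rintro H _ (_ | ⟨ha, hs⟩)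
      have := (ih _).1 (H _ ha) _ hs
      simpa [mul_assoc] using this
    · intro H as ha
      refine (ih _).2 fun ass hs => ?_
      simpa [mul_assoc] using H _ (.cons ha hs)

theorem prod_map_weightedSup_le_iff (φ : LRel A B) (h : A → Q) (bs : List B) (x : Q) :
    (bs.map (weightedSup φ h)).prod ≤ x ↔
      ∀ ass : List (List A), List.Forall₂ φ ass bs → (ass.flatten.map h).prod ≤ x := by
  simpa using mul_prod_map_weightedSup_le_iff φ h bs 1 x

end Quantale

/-! ### Discrete categories, where every relation is a weight, and separatedness. -/

namespace LTwoCat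

/-- The discrete `(L, 𝟐)`-category on a type. -/
def discrete (A : Type u) : LTwoCat.{u} where
  carrier := A
  rel := LRel.one A
  one_le := le_rfl
  comp_le := by
    rintro _ x ⟨xss, ys, rfl, h, rfl⟩
    cases h with
    | cons h₁ h₂ =>
      cases h₂
      cases h₁
      rfl

/-- Every map out of a discrete `(L, 𝟐)`-category is a functor. -/
def Functor.ofDiscrete {A : Type u} {X : LTwoCat.{u}} (f : A → X) : Functor (discrete A) X where
  toFun := f
  map_rel := by
    rintro _ x rfl
    exact X.one_le _ _ rfl

/-- Every relation is a distributor between discrete `(L, 𝟐)`-categories. -/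
def Distributor.ofRel {A B : Type u} (φ : LRel A B) :
    Distributor (discrete A) (discrete B) where
  rel := φ
  comp_le := by
    rintro _ b ⟨xss, ys, rfl, h, hb⟩
    have : xss.flatten = ys := by
      clear hb
      induction h with
      | nil => rfl
      | cons h _ ih =>
        cases h
        exact congrArg (_ :: ·) ih
    exact this ▸ hb
  le_comp := by
    rintro _ b ⟨xss, ys, rfl, h, rfl⟩
    cases h with
    | cons h₁ h₂ =>
      cases h₂
      simpa using h₁

theorem rel_refl (X : LTwoCat.{u}) (x : X) : X.rel [x] x := X.one_le _ _ rfl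

theorem forall₂_rel_refl (X : LTwoCat.{u}) (xs : List X) :
    List.Forall₂ X.rel (xs.map fun x => [x]) xs := by
  induction xs with
  | nil => exact .nil
  | cons x xs ih => exact .cons (X.rel_refl x) ih

theorem rel_trans (X : LTwoCat.{u}) {xs : List X} {x y : X} (h : X.rel xs x) (h' : X.rel [x] y) :
    X.rel xs y :=
  X.comp_le _ _ ⟨[xs], [x], by simp, .cons h .nil, h'⟩

theorem IsSeparated.antisymm {X : LTwoCat.{u}} (hX : X.IsSeparated) {x y : X}
    (h : X.rel [x] y) (h' : X.rel [y] x) : x = y :=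
  congrArg (fun f => f.toFun PUnit.unit)
    (hX (discrete PUnit) (.ofDiscrete fun _ => x) (.ofDiscrete fun _ => y)
      ⟨fun _ => h, fun _ => h'⟩)

theorem IsSeparated.eq_of_forall_rel_iff {X : LTwoCat.{u}} (hX : X.IsSeparated) {x y : X}
    (h : ∀ z, X.rel [x] z ↔ X.rel [y] z) : x = y :=
  hX.antisymm ((h y).2 (X.rel_refl y)) ((h x).1 (X.rel_refl x))

/-- The membership relation between lists and sets of lists. -/
def memDistributor (X : Type u) : Distributor (discrete X) (discrete (Set (List X))) :=
  .ofRel fun xs S => xs ∈ S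

/-! ### The quantale of a cocomplete separated `(L, 𝟐)`-category -/

section OfCocomplete

variable {X : LTwoCat.{u}} (hX : X.IsCocomplete)

/-- The colimit of the tensor products of a set of lists. -/
noncomputable def IsCocomplete.sup (S : Set (List X)) : X :=
  (hX _ _ (memDistributor X) (.ofDiscrete fun x => x)).choose.toFun S

/-- The colimit property is an equality of relations on whole lists; this is what later makes
suprema stable under context. -/
theorem IsCocomplete.rel_map_sup_iff (Ss : List (Set (List X))) (x : X) :
    X.rel (Ss.map hX.sup) x ↔
      ∀ xss : List (List X), List.Forall₂ (fun xs S => xs ∈ S) xss Ss → X.rel xss.flatten x := by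
  have h := congrFun₂ (hX _ _ (memDistributor X) (.ofDiscrete fun x => x)).choose_spec Ss x
  refine (iff_of_eq h).trans (forall₂_congr fun xss _ => ?_)
  exact iff_of_eq (congrArg (X.rel · x) (List.map_id _))

variable (hs : X.IsSeparated)

theorem IsCocomplete.rel_sup_iff (S : Set (List X)) (x : X) :
    X.rel [hX.sup S] x ↔ ∀ xs ∈ S, X.rel xs x := by
  refine (hX.rel_map_sup_iff [S] x).trans ⟨fun h xs hx => ?_, ?_⟩
  · simpa using h [xs] (.cons hx .nil)
  · rintro h _ (_ | ⟨hx, _ | _⟩)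
    simpa using h _ hx

/-- The sets `{[x]}` leave no choice of block, so only the block taken from `S` is free. -/
theorem exists_flatten_eq_of_forall₂_mem {α : Type u} {l₁ l₂ : List α} {S : Set (List α)}
    {xss : List (List α)}
    (h : List.Forall₂ (fun xs (S : Set (List α)) => xs ∈ S) xss
      (l₁.map (fun x => {[x]}) ++ S :: l₂.map (fun x => {[x]}))) :
    ∃ m ∈ S, xss.flatten = l₁ ++ m ++ l₂ := by
  induction l₁ generalizing xss with
  | nil =>
    obtain _ | @⟨m, _, xss, _, hm, h⟩ := h
    refine ⟨m, hm, congrArg (m ++ ·) ?_⟩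
    clear hm
    induction l₂ generalizing xss with
    | nil => cases h; rfl
    | cons x l₂ ih =>
      obtain _ | ⟨rfl, h⟩ := h
      exact congrArg (x :: ·) (ih h)
  | cons x l₁ ih =>
    obtain _ | ⟨rfl, h⟩ := h
    obtain ⟨m, hm, e⟩ := ih h
    exact ⟨m, hm, congrArg (x :: ·) e⟩

include hs in
theorem IsCocomplete.sup_singleton (x : X) : hX.sup {[x]} = x :=
  hs.eq_of_forall_rel_iff fun z => by simp [hX.rel_sup_iff]

include hs in
theorem IsCocomplete.rel_append_sup_append_iff (l₁ l₂ : List X) (S : Set (List X)) (z : X) :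
    X.rel (l₁ ++ hX.sup S :: l₂) z ↔ ∀ m ∈ S, X.rel (l₁ ++ m ++ l₂) z := by
  constructor
  · intro h m hm
    refine X.comp_le _ _ ⟨l₁.map (fun x => [x]) ++ m :: l₂.map (fun x => [x]), _, ?_,
      List.rel_append (X.forall₂_rel_refl l₁) (.cons ?_ (X.forall₂_rel_refl l₂)), h⟩
    · simp [← List.flatMap_def]
    · exact (hX.rel_sup_iff S _).1 (X.rel_refl _) m hm
  · intro h
    -- Each context entry is `x = sup {[x]}`, so the whole list is an image under `sup`.
    have := hX.rel_map_sup_iff (l₁.map (fun x => {[x]}) ++ S :: l₂.map (fun x => {[x]})) z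
    simp only [List.map_append, List.map_cons, List.map_map, Function.comp_def,
      hX.sup_singleton hs, List.map_id'] at this
    refine this.2 fun xss hxss => ?_
    obtain ⟨m, hm, e⟩ := exists_flatten_eq_of_forall₂_mem hxss
    exact e ▸ h m hm

include hs in
theorem IsCocomplete.rel_append_sup_singleton_append_iff (l₁ l₂ m : List X) (z : X) :
    X.rel (l₁ ++ hX.sup {m} :: l₂) z ↔ X.rel (l₁ ++ m ++ l₂) z := by
  simp [hX.rel_append_sup_append_iff hs]

/-- The order of a separated `(L, 𝟐)`-category. -/
abbrev IsSeparated.partialOrder : PartialOrder X where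
  le x y := X.rel [x] y
  le_refl := X.rel_refl
  le_trans _ _ _ := X.rel_trans
  le_antisymm _ _ := hs.antisymm

/-- The complete lattice underlying a cocomplete separated `(L, 𝟐)`-category. -/
noncomputable abbrev IsCocomplete.completeLattice : CompleteLattice X :=
  letI := hs.partialOrder
  letI : SupSet X := ⟨fun S => hX.sup ((fun x => [x]) '' S)⟩
  completeLatticeOfSup X fun _ => isLUB_iff_le_iff.2 fun z =>
    (hX.rel_sup_iff _ z).trans Set.forall_mem_image

/-- The tensor product of a cocomplete separated `(L, 𝟐)`-category. -/
noncomputable abbrev IsCocomplete.monoid : Monoid X where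
  one := hX.sup {[]}
  mul x y := hX.sup {[x, y]}
  mul_assoc x y z := hs.eq_of_forall_rel_iff fun w => by
    change X.rel [hX.sup {[hX.sup {[x, y]}, z]}] w ↔ X.rel [hX.sup {[x, hX.sup {[y, z]}]}] w
    simpa [hX.rel_sup_iff] using (hX.rel_append_sup_singleton_append_iff hs [] [z] [x, y] w).trans
      (hX.rel_append_sup_singleton_append_iff hs [x] [] [y, z] w).symm
  one_mul x := hs.eq_of_forall_rel_iff fun w => by
    change X.rel [hX.sup {[hX.sup {[]}, x]}] w ↔ _
    simpa [hX.rel_sup_iff] using hX.rel_append_sup_singleton_append_iff hs [] [x] [] w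
  mul_one x := hs.eq_of_forall_rel_iff fun w => by
    change X.rel [hX.sup {[x, hX.sup {[]}]}] w ↔ _
    simpa [hX.rel_sup_iff] using hX.rel_append_sup_singleton_append_iff hs [x] [] [] w

theorem IsCocomplete.isQuantale :
    @IsQuantale X (hX.monoid hs).toSemigroup (hX.completeLattice hs) := by
  let := hX.completeLattice hs
  let := hX.monoid hs
  have key (x y z : X) : x * y ≤ z ↔ X.rel [x, y] z :=
    (hX.rel_sup_iff {[x, y]} z).trans forall_eq
  refine ⟨fun x S => eq_of_forall_ge_iff fun z => ?_, fun S x => eq_of_forall_ge_iff fun z => ?_⟩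
  · rw [iSup₂_le_iff, key]
    simp only [key]
    exact (hX.rel_append_sup_append_iff hs [x] [] _ z).trans Set.forall_mem_image
  · rw [iSup₂_le_iff, key]
    simp only [key]
    exact (hX.rel_append_sup_append_iff hs [] [x] _ z).trans Set.forall_mem_image

theorem IsCocomplete.prod_le_iff (xs : List X) (z : X) :
    letI := hX.completeLattice hs
    letI := hX.monoid hs
    xs.prod ≤ z ↔ X.rel xs z := by
  let := hX.monoid hs
  -- The prefix `l` collects the factors already split off from the right-nested product.
  have key (l : List X) : X.rel (l ++ [xs.prod]) z ↔ X.rel (l ++ xs) z := by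
    induction xs generalizing l with
    | nil =>
      refine (hX.rel_append_sup_singleton_append_iff hs l [] [] z).trans ?_
      rw [List.append_nil]
    | cons x xs ih =>
      refine (hX.rel_append_sup_singleton_append_iff hs l [] [x, xs.prod] z).trans ?_
      simpa using ih (l ++ [x])
  exact key []

end OfCocomplete

end LTwoCat

/-! ### From quantales to cocomplete separated categories, fully faithfully. -/

namespace Quant

open LTwoCat

/-- The `(L, 𝟐)`-category of a quantale: `(x₁, …, xₙ)` is related to `y` when
`x₁ ⋯ xₙ ≤ y`. -/
abbrev toLTwoCat (Q : Quant.{u}) : LTwoCat.{u} where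
  carrier := Q
  rel xs x := xs.prod ≤ x
  one_le := by
    rintro _ x rfl
    simp
  comp_le := by
    rintro _ x ⟨xss, ys, rfl, h, hx⟩
    -- Each `y` is the supremum of the products below it, so the composition axiom becomes an
    -- instance of the colimit formula.
    have e : ys.map (weightedSup (fun (xs : List Q) y => xs.prod ≤ y) id) = ys := by
      refine (List.map_congr_left fun y _ => eq_of_forall_ge_iff fun z => ?_).trans
        (List.map_id ys)
      rw [weightedSup_le_iff]
      simp only [List.map_id, id]
      exact ⟨fun h => by simpa using h [y] (by simp), fun h _ h' => h'.trans h⟩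
    have := (prod_map_weightedSup_le_iff _ id ys x).1 (by rwa [e]) xss h
    rwa [List.map_id] at this

theorem toLTwoCat_rel {Q : Quant.{u}} {xs : List Q} {x : Q} :
    Q.toLTwoCat.rel xs x ↔ xs.prod ≤ x := Iff.rfl

theorem toLTwoCat_rel_singleton {Q : Quant.{u}} {x y : Q} :
    Q.toLTwoCat.rel [x] y ↔ x ≤ y := by
  rw [toLTwoCat_rel, List.prod_singleton]

theorem isSeparated_toLTwoCat (Q : Quant.{u}) : Q.toLTwoCat.IsSeparated := fun _ _ _ h =>
  LTwoCat.Functor.ext <| funext fun y =>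
    le_antisymm (toLTwoCat_rel_singleton.1 (h.1 y)) (toLTwoCat_rel_singleton.1 (h.2 y))

/-- Colimits in a quantale are given by the pointwise formula. -/
theorem isColimit_iff {Q : Quant.{u}} {A B : LTwoCat.{u}} {φ : Distributor A B}
    {h : Functor A Q.toLTwoCat} {g : Functor B Q.toLTwoCat} :
    IsColimit φ h g ↔ g.toFun = weightedSup (Q := Q) φ.rel h.toFun := by
  constructor
  · intro H
    refine funext fun b => eq_of_forall_ge_iff fun (x : Q) => ?_
    -- One-entry lists already determine `g`; the converse needs the formula for all lists.
    have := iff_of_eq (congrFun₂ H [b] x)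
    refine (toLTwoCat_rel_singleton.symm.trans this).trans ?_
    refine (prod_map_weightedSup_le_iff (Q := Q) φ.rel h.toFun [b] x).symm.trans ?_
    rw [List.map_singleton, List.prod_singleton]
  · intro H
    refine funext₂ fun bs x => propext ?_
    change (bs.map g.toFun).prod ≤ x ↔ _
    rw [H]
    exact prod_map_weightedSup_le_iff (Q := Q) φ.rel h.toFun bs x

theorem isCocomplete_toLTwoCat (Q : Quant.{u}) : Q.toLTwoCat.IsCocomplete := fun _ _ φ h =>
  ⟨{ toFun := weightedSup (Q := Q) φ.rel h.toFun
     map_rel := fun bs b hb => (prod_map_weightedSup_le_iff (Q := Q) _ _ _ _).2 fun ass ha =>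
      (weightedSup_le_iff (Q := Q) φ.rel h.toFun b _).1 le_rfl _
        (φ.le_comp _ _ ⟨ass, bs, rfl, ha, hb⟩) }, isColimit_iff.2 rfl⟩

/-- The cocomplete separated `(L, 𝟐)`-category of a quantale. -/
abbrev toInjTwo (Q : Quant.{u}) : InjTwo.{u} :=
  ⟨Q.toLTwoCat, Q.isSeparated_toLTwoCat, Q.isCocomplete_toLTwoCat⟩

theorem Hom.monotone {P Q : Quant.{u}} (f : Hom P Q) : Monotone f.toFun :=
  OrderHomClass.mono f.tosSupHom

theorem Hom.map_weightedSup {P Q : Quant.{u}} (f : Hom P Q) {A B : Type u} (φ : LRel A B)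
    (h : A → P) (b : B) :
    f.toFun (weightedSup φ h b) = weightedSup φ (fun a => f.toFun (h a)) b := by
  refine (map_iSup f.tosSupHom _).trans (iSup_congr fun as => ?_)
  refine (map_list_prod f.toMonoidHom _).trans ?_
  rw [List.map_map]
  rfl

/-- The cocontinuous functor of a morphism of quantales. -/
def Hom.toInjTwoHom {P Q : Quant.{u}} (f : Hom P Q) : InjTwo.Hom P.toInjTwo Q.toInjTwo where
  toFunctor :=
    { toFun := f.toFun
      map_rel := fun xs _ h =>
        (map_list_prod f.toMonoidHom xs).symm.le.trans (f.monotone h) }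
  isCocontinuous _ _ φ h _ H := isColimit_iff.2 <| funext fun b =>
    (congrArg f.toFun (congrFun (isColimit_iff.1 H) b)).trans (f.map_weightedSup φ.rel h.toFun b)

/-- Weights into a point on the tautological diagram suffice: one-list weights give products, and
weights supported on one-entry lists give `sSup`. -/
theorem map_weightedSup_of_isCocontinuous {P Q : Quant.{u}}
    {f : LTwoCat.Functor P.toLTwoCat Q.toLTwoCat} (hf : f.IsCocontinuous) (φ : LRel P PUnit.{u + 1}) :
    f.toFun (weightedSup (Q := P) φ id PUnit.unit) =
      weightedSup (Q := Q) φ f.toFun PUnit.unit :=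
  congrFun (isColimit_iff.1 (hf _ _ (.ofRel φ) (.ofDiscrete (X := P.toLTwoCat) id)
    (.ofDiscrete (X := P.toLTwoCat) (weightedSup (Q := P) φ id)) (isColimit_iff.2 rfl))) PUnit.unit

theorem weightedSup_eq {Q : Type u} [CompleteLattice Q] [Monoid Q] {A : Type u}
    (as : List A) (h : A → Q) :
    weightedSup (fun l (_ : PUnit.{u + 1}) => l = as) h PUnit.unit = (as.map h).prod :=
  eq_of_forall_ge_iff fun _ => by rw [weightedSup_le_iff, forall_eq]

theorem weightedSup_singleton {Q : Type u} [CompleteLattice Q] [Monoid Q] {A : Type u}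
    (S : Set A) (h : A → Q) :
    weightedSup (fun l (_ : PUnit.{u + 1}) => ∃ x ∈ S, l = [x]) h PUnit.unit = sSup (h '' S) :=
  eq_of_forall_ge_iff fun _ => by
    rw [weightedSup_le_iff, sSup_le_iff, Set.forall_mem_image]
    constructor
    · intro H x hx
      simpa using H [x] ⟨x, hx, rfl⟩
    · rintro H _ ⟨x, hx, rfl⟩
      simpa using H hx

theorem map_prod_of_isCocontinuous {P Q : Quant.{u}}
    {f : LTwoCat.Functor P.toLTwoCat Q.toLTwoCat} (hf : f.IsCocontinuous) (xs : List P) :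
    f.toFun xs.prod = (xs.map f.toFun : List Q).prod := by
  simpa [weightedSup_eq] using map_weightedSup_of_isCocontinuous hf fun l _ => l = xs

theorem map_sSup_of_isCocontinuous {P Q : Quant.{u}}
    {f : LTwoCat.Functor P.toLTwoCat Q.toLTwoCat} (hf : f.IsCocontinuous) (S : Set P) :
    f.toFun (sSup S) = (sSup (f.toFun '' S) : Q) := by
  simpa [weightedSup_singleton] using
    map_weightedSup_of_isCocontinuous hf fun l _ => ∃ x ∈ S, l = [x]

/-- The morphism of quantales of a cocontinuous functor. -/
def homOfInjTwoHom {P Q : Quant.{u}} (f : InjTwo.Hom P.toInjTwo Q.toInjTwo) : Hom P Q where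
  toFun := f.toFunctor.toFun
  map_sSup' := map_sSup_of_isCocontinuous f.isCocontinuous
  map_one' := map_prod_of_isCocontinuous f.isCocontinuous []
  map_mul' x y := by simpa using map_prod_of_isCocontinuous f.isCocontinuous [x, y]

/-- The functor from quantales to cocomplete separated `(L, 𝟐)`-categories. -/
def toInjTwoFunctor : Quant.{u} ⥤ InjTwo.{u} where
  obj := toInjTwo
  map := Hom.toInjTwoHom

/-- `toInjTwoFunctor` is fully faithful. -/
def fullyFaithfulToInjTwoFunctor : toInjTwoFunctor.{u}.FullyFaithful where
  preimage := homOfInjTwoHom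
  map_preimage _ := rfl
  preimage_map _ := rfl

end Quant

/-! ### Essential surjectivity and the equivalence. -/

/-- The quantale of a cocomplete separated `(L, 𝟐)`-category. -/
noncomputable def InjTwo.toQuant (X : InjTwo.{u}) : Quant.{u} :=
  letI := X.isCocomplete.completeLattice X.isSeparated
  letI := X.isCocomplete.monoid X.isSeparated
  haveI := X.isCocomplete.isQuantale X.isSeparated
  ⟨X.toLTwoCat⟩

/-- The carrier is unchanged and the other fields are propositions, so equality of the relations,
from `prod_le_iff`, gives equality of objects. -/
theorem InjTwo.toInjTwo_toQuant (X : InjTwo.{u}) : X.toQuant.toInjTwo = X := by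
  obtain ⟨⟨C, r, h₁, h₂⟩, hs, hc⟩ := X
  have : (InjTwo.toQuant ⟨⟨C, r, h₁, h₂⟩, hs, hc⟩).toLTwoCat.rel = r :=
    funext₂ fun xs x => propext (hc.prod_le_iff hs xs x)
  refine (InjTwo.mk.injEq ..).mpr ((LTwoCat.mk.injEq ..).mpr ⟨rfl, heq_of_eq this⟩)

theorem mainTheorem3 : Nonempty (InjTwo.{u} ≌ Quant.{u}) := by
  have := Quant.fullyFaithfulToInjTwoFunctor.{u}.full
  have := Quant.fullyFaithfulToInjTwoFunctor.{u}.faithful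
  have : Quant.toInjTwoFunctor.{u}.EssSurj :=
    ⟨fun X => ⟨X.toQuant, ⟨eqToIso X.toInjTwo_toQuant⟩⟩⟩
  have : Quant.toInjTwoFunctor.{u}.IsEquivalence := {}
  exact ⟨Quant.toInjTwoFunctor.{u}.asEquivalence.symm⟩
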